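/- Let $a_0,a_1,a_2\in\mathbb R$ and $0<\tau_1<\tau_2$ be real numbers with $\tau_1/\tau_2=1/2$, and let $s_0\in\mathbb R$. Consider the delay-differential equation $$y'(t)+a_0y(t)+a_1y(t-\tau_1)+a_2y(t-\tau_2)=0,\qquad t\ge 0,$$ and its characteristic function $\Delta:\mathbb C\to\mathbb C$, $\Delta(s)=s+a_0+a_1e^{-s\tau_1}+a_2e^{-s\tau_2}$. Suppose that $s_0$ is a root of $\Delta$ of multiplicity $3$ (exactly). Then $s_0$ is a strictly dominant root of $\Delta$: every $s\in\mathbb C$ with $\Delta(s)=0$ satisfies $s=s_0$ or $\operatorname{Re}s<s_0$. In particular, if $s_0<0$, then the equation is exponentially stable: there exist $K>0$ and $\alpha>0$ such that every solution $y:[-\tau_2,\infty)\to\mathbb R$ (continuous on $[-\tau_2,\infty)$ and differentiable on $[0,\infty)$, with the right derivative at $0$, satisfying the equation for all $t\ge 0$) obeys $$|y(t)|\le K e^{-\alpha t}\max_{\theta\in[-\tau_2,0]}|y(\theta)|\qquad\text{for all }t\ge 0.$$ -/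

import Mathlib

namespace TwoDelay

/-- The characteristic function `Δ(s) = s + a₀ + a₁ e^{-s τ₁} + a₂ e^{-s τ₂}` of the equation
`y'(t) + a₀ y(t) + a₁ y(t - τ₁) + a₂ y(t - τ₂) = 0`. -/
noncomputable def charFun (a₀ a₁ a₂ τ₁ τ₂ : ℝ) (s : ℂ) : ℂ :=
  s + a₀ + a₁ * Complex.exp (-s * τ₁) + a₂ * Complex.exp (-s * τ₂)

/-- `s₀` is a root of `D` of multiplicity exactly `m` (order of vanishing of `D` at `s₀`). -/
def IsRootOfMultiplicity (D : ℂ → ℂ) (s₀ : ℂ) (m : ℕ) : Prop :=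
  D s₀ = 0 ∧ AnalyticAt ℂ D s₀ ∧ analyticOrderAt D s₀ = m

/-- The real number `s₀` is a strictly dominant root of `D`: it is a root, and every root `s`
satisfies `s = s₀` or `Re s < s₀`. -/
def IsStrictlyDominantRoot (D : ℂ → ℂ) (s₀ : ℝ) : Prop :=
  D s₀ = 0 ∧ ∀ s : ℂ, D s = 0 → s = s₀ ∨ s.re < s₀

/-- `y` (relevant on `[-τ₂, ∞)` only, where `0 < τ₁ < τ₂`) is a solution of
`y'(t) + a₀ y(t) + a₁ y(t - τ₁) + a₂ y(t - τ₂) = 0` for `t ≥ 0`, with continuous initial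
history on `[-τ₂, 0]`. At `t = 0` the derivative is the right derivative. -/
def IsSolution (a₀ a₁ a₂ τ₁ τ₂ : ℝ) (y : ℝ → ℝ) : Prop :=
  ContinuousOn y (Set.Ici (-τ₂)) ∧
    ∀ t : ℝ, 0 ≤ t →
      HasDerivWithinAt y (-(a₀ * y t + a₁ * y (t - τ₁) + a₂ * y (t - τ₂))) (Set.Ici 0) t

/-- The supremum norm `max_{θ ∈ [-τ₂, 0]} |y θ|` of the initial history of `y`. -/
noncomputable def historyNorm (τ₂ : ℝ) (y : ℝ → ℝ) : ℝ :=
  sSup ((fun θ => |y θ|) '' Set.Icc (-τ₂) 0)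

/-- Exponential stability of the delay-differential equation: all solutions satisfy
`|y t| ≤ K e^{-α t} max_{[-τ₂, 0]} |y|` for `t ≥ 0`, with `K, α > 0` independent of the solution. -/
def IsExponentiallyStable (a₀ a₁ a₂ τ₁ τ₂ : ℝ) : Prop :=
  ∃ K α : ℝ, 0 < K ∧ 0 < α ∧
    ∀ y : ℝ → ℝ, IsSolution a₀ a₁ a₂ τ₁ τ₂ y →
      ∀ t : ℝ, 0 ≤ t → |y t| ≤ K * Real.exp (-α * t) * historyNorm τ₂ y

end TwoDelay

/-! With `τ = τ₁` and `τ₂ = 2τ`, vanishing of `Δ`, `Δ'`, `Δ''` at `s₀` fixes the coefficients, and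
`2τ Δ(s) = N((s - s₀)τ)` with `N = normalizedCharFun`. Since `N(0) = 0` and `N'(z) = 2(1 -
e^{-z})²`, one has `N(z)/z = ∫₀¹ 2(1 - e^{-tz})² dt`. If `Re z ≥ 0` and `0 < Im z < π`, the
integrand has positive imaginary part for `0 < t ≤ 1`, so `N(z) ≠ 0`. A root with `Re z ≥ 0` has `Im
z ≤ 3 < π`; conjugation handles `Im z < 0`, and monotonicity of `N` handles the positive real axis.

For stability, advancing a solution by `τ` is a bounded operator `T` on pairs of continuous
functions. Any nonzero `l` in the spectrum of `T` equals `e^{sτ}` for a root `s` of `Δ`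
(`exp_eq_of_mem_spectrum_stepCLM`), so dominance bounds the spectral radius by `e^{s₀τ} < 1`.
Gelfand's formula then gives geometric decay of `Tⁿ`. -/

namespace TwoDelay

/-! ### Roots of the normalized characteristic function -/

/-- The characteristic function with a triple root at `0` and delays `1` and `2`, up to a factor
`2`. -/
noncomputable def normalizedCharFun (z : ℂ) : ℂ :=
  2 * z - 3 + 4 * Complex.exp (-z) - Complex.exp (-z) ^ 2

theorem normalizedCharFun_conj (z : ℂ) :
    normalizedCharFun (starRingEnd ℂ z) = starRingEnd ℂ (normalizedCharFun z) := by
  simp [normalizedCharFun, ← Complex.exp_conj, Complex.conj_ofNat]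

theorem hasDerivAt_normalizedCharFun_ray {z : ℂ} (hz : z ≠ 0) (t : ℝ) :
    HasDerivAt (fun t : ℝ => normalizedCharFun (t * z) / z)
      (2 * (1 - Complex.exp (-(t * z))) ^ 2) t := by
  have hlin : HasDerivAt (fun t : ℝ => (t : ℂ) * z) z t := by
    simpa using (Complex.ofRealCLM.hasDerivAt (x := t)).mul_const z
  have hexp := hlin.neg.cexp
  have h := ((((hlin.const_mul 2).sub_const 3).add (hexp.const_mul 4)).sub
    (hexp.pow 2)).div_const z
  refine h.congr_deriv ?_
  field_simp
  simp
  ring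

/-- Writing `e^{-z} = u + iv`, the imaginary part of the equation reads `Im z = v(u - 2)`, where
`|u|, |v| ≤ 1`. -/
theorem im_le_three_of_normalizedCharFun_eq_zero {z : ℂ} (hre : 0 ≤ z.re)
    (h : normalizedCharFun z = 0) : z.im ≤ 3 := by
  have him := congrArg Complex.im h
  simp only [normalizedCharFun] at him
  have hnorm : ‖Complex.exp (-z)‖ ≤ 1 := by
    rw [Complex.norm_exp]; simpa using hre
  have hsq : (Complex.exp (-z)).re ^ 2 + (Complex.exp (-z)).im ^ 2 ≤ 1 := by
    have := Complex.sq_norm (Complex.exp (-z))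
    rw [Complex.normSq_apply] at this
    nlinarith [norm_nonneg (Complex.exp (-z))]
  generalize Complex.exp (-z) = w at him hsq
  obtain ⟨u, v⟩ := w
  simp [pow_two] at him hsq
  have hu : |u| ≤ 1 := abs_le_one_iff_mul_self_le_one.2 (by nlinarith)
  have hv : |v| ≤ 1 := abs_le_one_iff_mul_self_le_one.2 (by nlinarith)
  rw [abs_le] at hu hv
  nlinarith

theorem normalizedCharFun_ne_zero_of_im_pos {z : ℂ} (hre : 0 ≤ z.re) (him : 0 < z.im) :
    normalizedCharFun z ≠ 0 := by
  intro h
  have hpi : z.im < Real.pi :=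
    (im_le_three_of_normalizedCharFun_eq_zero hre h).trans_lt Real.pi_gt_three
  have hz : z ≠ 0 := by rintro rfl; simp at him
  have hder (t : ℝ) := (Complex.imCLM.hasFDerivAt.comp_hasDerivAt t
    (hasDerivAt_normalizedCharFun_ray hz t))
  have hmono : StrictMonoOn (fun t : ℝ => (normalizedCharFun (t * z) / z).im) (Set.Icc 0 1) := by
    refine strictMonoOn_of_deriv_pos (convex_Icc 0 1)
      (fun t _ => (hder t).continuousAt.continuousWithinAt) fun t ht => ?_
    rw [interior_Icc] at ht
    have hd : deriv (fun t : ℝ => (normalizedCharFun (t * z) / z).im) t =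
        (2 * (1 - Complex.exp (-(t * z))) ^ 2).im := (hder t).deriv
    have hty : 0 < t * z.im := mul_pos ht.1 him
    have hty' : t * z.im < Real.pi := by nlinarith [ht.2]
    have hsin := Real.sin_pos_of_pos_of_lt_pi hty hty'
    have hcos : Real.cos (t * z.im) < 1 := by
      nlinarith [Real.sin_sq_add_cos_sq (t * z.im), Real.cos_le_one (t * z.im)]
    have hexp : Real.exp (-(t * z.re)) ≤ 1 := by
      simpa using mul_nonneg ht.1.le hre
    have hpos := Real.exp_pos (-(t * z.re))
    -- The imaginary part of a square is twice the product of real and imaginary parts; both factors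
    -- are positive here.
    have him' : (2 * (1 - Complex.exp (-(t * z))) ^ 2).im =
        4 * (1 - Real.exp (-(t * z.re)) * Real.cos (t * z.im)) *
          (Real.exp (-(t * z.re)) * Real.sin (t * z.im)) := by
      simp [pow_two, Complex.exp_re, Complex.exp_im]
      ring
    rw [hd, him']
    have : 0 < 1 - Real.exp (-(t * z.re)) * Real.cos (t * z.im) := by nlinarith
    positivity
  have := hmono (Set.left_mem_Icc.2 zero_le_one) (Set.right_mem_Icc.2 zero_le_one) zero_lt_one
  -- The function vanishes at `t = 1` by `h` and at `t = 0` because `N(0) = 0`, contradicting strict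
  -- monotonicity.
  simp [h] at this
  simp [normalizedCharFun] at this
  norm_num at this

theorem normalizedCharFun_ofReal_ne_zero {x : ℝ} (hx : 0 < x) :
    normalizedCharFun x ≠ 0 := by
  intro h
  have hder (t : ℝ) : HasDerivAt (fun t : ℝ => 2 * t - 3 + 4 * Real.exp (-t) - Real.exp (-t) ^ 2)
      (2 * (1 - Real.exp (-t)) ^ 2) t := by
    have hexp := (hasDerivAt_id t).neg.exp
    refine (((((hasDerivAt_id t).const_mul 2).sub_const 3).add (hexp.const_mul 4)).sub
      (hexp.pow 2)).congr_deriv ?_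
    simp
    ring
  have hmono : StrictMonoOn (fun t : ℝ => 2 * t - 3 + 4 * Real.exp (-t) - Real.exp (-t) ^ 2)
      (Set.Ici 0) := by
    refine strictMonoOn_of_deriv_pos (convex_Ici 0)
      (fun t _ => (hder t).continuousAt.continuousWithinAt) fun t ht => ?_
    rw [interior_Ici] at ht
    rw [(hder t).deriv]
    have : Real.exp (-t) < 1 := by simpa using ht
    have : 0 < 1 - Real.exp (-t) := by linarith
    positivity
  have := hmono (Set.mem_Ici.2 le_rfl) (Set.mem_Ici.2 hx.le) hx
  have h' : 2 * x - 3 + 4 * Real.exp (-x) - Real.exp (-x) ^ 2 = 0 := by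
    exact_mod_cast (by simpa [normalizedCharFun] using h :
      2 * (x : ℂ) - 3 + 4 * Complex.exp (-x) - Complex.exp (-x) ^ 2 = 0)
  norm_num [h'] at this

theorem eq_zero_of_normalizedCharFun_eq_zero {z : ℂ} (hre : 0 ≤ z.re)
    (h : normalizedCharFun z = 0) : z = 0 := by
  rcases lt_trichotomy z.im 0 with him | him | him
  · refine absurd ?_ (normalizedCharFun_ne_zero_of_im_pos (z := starRingEnd ℂ z)
      (by simpa using hre) (by simpa using him))
    rw [normalizedCharFun_conj, h, map_zero]
  · obtain ⟨x, y⟩ := z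
    simp only at him hre
    subst him
    rcases hre.eq_or_lt with rfl | hx
    · rfl
    · exact absurd h (normalizedCharFun_ofReal_ne_zero hx)
  · exact absurd h (normalizedCharFun_ne_zero_of_im_pos hre him)

/-! ### Reduction of a triple root to the normalized form -/

theorem hasDerivAt_charFun (a₀ a₁ a₂ τ₁ τ₂ : ℝ) (s : ℂ) :
    HasDerivAt (charFun a₀ a₁ a₂ τ₁ τ₂)
      (1 - a₁ * τ₁ * Complex.exp (-s * τ₁) - a₂ * τ₂ * Complex.exp (-s * τ₂)) s := by
  have hexp (τ : ℝ) : HasDerivAt (fun s : ℂ => Complex.exp (-s * τ))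
      (Complex.exp (-s * τ) * (-1 * τ)) s := ((hasDerivAt_id s).neg.mul_const _).cexp
  refine ((((hasDerivAt_id s).add_const (a₀ : ℂ)).add ((hexp τ₁).const_mul (a₁ : ℂ))).add
    ((hexp τ₂).const_mul (a₂ : ℂ))).congr_deriv ?_
  ring

/-- With `A`, `B` the two left-hand sides, `Δ'(s₀) = 0` and `Δ''(s₀) = 0` are the linear system `τA
+ 2τB = 1`, `A + 4B = 0`. -/
theorem coeff_eq_of_triple_root {a₀ a₁ a₂ τ s₀ : ℝ} (hτ : 0 < τ)
    (h : IsRootOfMultiplicity (charFun a₀ a₁ a₂ τ (2 * τ)) s₀ 3) :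
    a₁ * Complex.exp (-s₀ * τ) = 2 / τ ∧
      a₂ * Complex.exp (-s₀ * (2 * τ : ℝ)) = -1 / (2 * τ) := by
  obtain ⟨-, han, hord⟩ := h
  have hz := (natCast_le_analyticOrderAt_iff_iteratedDeriv_eq_zero han (n := 3)).1 hord.ge
  have h1 := hz 1 (by norm_num)
  have h2 := hz 2 (by norm_num)
  have hd : deriv (charFun a₀ a₁ a₂ τ (2 * τ)) = fun s : ℂ =>
      1 - a₁ * τ * Complex.exp (-s * τ) - a₂ * (2 * τ : ℝ) * Complex.exp (-s * (2 * τ : ℝ)) :=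
    funext fun s => (hasDerivAt_charFun a₀ a₁ a₂ τ (2 * τ) s).deriv
  rw [iteratedDeriv_one, hd] at h1
  beta_reduce at h1
  rw [iteratedDeriv_succ, iteratedDeriv_one, hd] at h2
  have hexp (τ : ℝ) : HasDerivAt (fun s : ℂ => Complex.exp (-s * τ))
      (Complex.exp (-s₀ * τ) * (-1 * τ)) s₀ :=
    ((hasDerivAt_id (s₀ : ℂ)).neg.mul_const _).cexp
  have hd2 := (((hexp τ).const_mul (a₁ * τ : ℂ)).const_sub 1).sub
    ((hexp (2 * τ)).const_mul (a₂ * (2 * τ : ℝ) : ℂ))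
  have h2' := hd2.deriv.symm.trans h2
  generalize Complex.exp (-s₀ * τ) = e₁ at *
  generalize Complex.exp (-s₀ * (2 * τ : ℝ)) = e₂ at *
  have hτ' : (τ : ℂ) ≠ 0 := by exact_mod_cast hτ.ne'
  push_cast at h1 h2'
  have h3 : a₁ * e₁ + 4 * (a₂ * e₂) = 0 := by
    refine (mul_eq_zero.1 (?_ : (τ : ℂ) ^ 2 * (a₁ * e₁ + 4 * (a₂ * e₂)) = 0)).resolve_left
      (pow_ne_zero 2 hτ')
    linear_combination h2'
  constructor
  · field_simp
    linear_combination (-2) * h1 - τ * h3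
  · field_simp
    linear_combination h1 + τ * h3

/-- The remaining condition `Δ(s₀) = 0` gives `a₀ + s₀ = -3/(2τ)`, the constant term of the
normalized function. -/
theorem charFun_eq_normalizedCharFun {a₀ a₁ a₂ τ s₀ : ℝ} (hτ : 0 < τ)
    (h : IsRootOfMultiplicity (charFun a₀ a₁ a₂ τ (2 * τ)) s₀ 3) (s : ℂ) :
    2 * τ * charFun a₀ a₁ a₂ τ (2 * τ) s = normalizedCharFun ((s - s₀) * τ) := by
  obtain ⟨h1, h2⟩ := coeff_eq_of_triple_root hτ h
  have h0 := h.1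
  have hτ' : (τ : ℂ) ≠ 0 := by exact_mod_cast hτ.ne'
  unfold charFun at *
  rw [h1, h2] at h0
  have e1 : Complex.exp (-s * τ) = Complex.exp (-s₀ * τ) * Complex.exp (-((s - s₀) * τ)) := by
    rw [← Complex.exp_add]; ring_nf
  have e2 : Complex.exp (-s * (2 * τ : ℝ)) =
      Complex.exp (-s₀ * (2 * τ : ℝ)) * Complex.exp (-((s - s₀) * τ)) ^ 2 := by
    rw [← Complex.exp_nat_mul, ← Complex.exp_add]; push_cast; ring_nf
  rw [e1, e2, normalizedCharFun, ← mul_assoc, ← mul_assoc, h1, h2]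
  field_simp at h0 ⊢
  linear_combination h0

theorem isStrictlyDominantRoot_of_triple_root {a₀ a₁ a₂ τ s₀ : ℝ} (hτ : 0 < τ)
    (h : IsRootOfMultiplicity (charFun a₀ a₁ a₂ τ (2 * τ)) s₀ 3) :
    IsStrictlyDominantRoot (charFun a₀ a₁ a₂ τ (2 * τ)) s₀ := by
  refine ⟨h.1, fun s hs => ?_⟩
  by_contra! hcon
  refine hcon.1 ?_
  have hz := charFun_eq_normalizedCharFun hτ h s
  rw [hs, mul_zero] at hz
  have := eq_zero_of_normalizedCharFun_eq_zero (by simp; nlinarith [hcon.2]) hz.symm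
  have hτ' : (τ : ℂ) ≠ 0 := by exact_mod_cast hτ.ne'
  exact sub_eq_zero.1 ((mul_eq_zero.1 this).resolve_right hτ')

/-! ### Power bounds from the spectral radius -/

open Set Filter Topology

/-- A power bound for elements of a Banach algebra, from Gelfand's formula. -/
theorem exists_norm_pow_le_of_spectralRadius_lt {A : Type*} [NormedRing A] [NormedAlgebra ℂ A]
    [CompleteSpace A] (a : A) {r : ℝ} (hr : 0 < r)
    (h : spectralRadius ℂ a < ENNReal.ofReal r) :
    ∃ C : ℝ, 0 < C ∧ ∀ n : ℕ, ‖a ^ n‖ ≤ C * r ^ n := by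
  have hev : ∀ᶠ n : ℕ in atTop, ‖a ^ n‖ ≤ r ^ n := by
    filter_upwards [(spectrum.pow_norm_pow_one_div_tendsto_nhds_spectralRadius a).eventually
      (gt_mem_nhds h), eventually_gt_atTop 0] with n hn hn0
    rw [ENNReal.ofReal_lt_ofReal_iff hr] at hn
    have hn' : (n : ℝ) ≠ 0 := by exact_mod_cast hn0.ne'
    calc ‖a ^ n‖ = (‖a ^ n‖ ^ (1 / n : ℝ)) ^ n := by
          rw [← Real.rpow_natCast, ← Real.rpow_mul (norm_nonneg _), one_div_mul_cancel hn',
            Real.rpow_one]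
      _ ≤ r ^ n := by gcongr
  obtain ⟨N, hN⟩ := eventually_atTop.1 hev
  have hterm (n : ℕ) : 0 ≤ ‖a ^ n‖ / r ^ n := by positivity
  -- The sum absorbs the finitely many exponents below `N`, where the eventual bound may fail.
  refine ⟨1 + ∑ n ∈ Finset.range N, ‖a ^ n‖ / r ^ n,
    add_pos_of_pos_of_nonneg one_pos (Finset.sum_nonneg fun n _ => hterm n), fun n => ?_⟩
  rw [← div_le_iff₀ (by positivity)]
  rcases lt_or_ge n N with hn | hn
  · have := Finset.single_le_sum (f := fun n => ‖a ^ n‖ / r ^ n) (fun n _ => hterm n)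
      (Finset.mem_range.2 hn)
    linarith
  · have h1 : ‖a ^ n‖ / r ^ n ≤ 1 := (div_le_one (by positivity)).2 (hN n hn)
    have := Finset.sum_nonneg (s := Finset.range N) fun n _ => hterm n
    linarith

/-! ### Scalar linear equations on an interval -/

/-- `h` solves `h' = c h + k` on `[0, τ]`. -/
def SolvesOn (τ : ℝ) (c : ℂ) (k h : ℝ → ℂ) : Prop :=
  ∀ t ∈ Icc 0 τ, HasDerivWithinAt h (c * h t + k t) (Icc 0 τ) t

theorem SolvesOn.congr {τ : ℝ} {c c' : ℂ} {k k' h h' : ℝ → ℂ} (H : SolvesOn τ c k h)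
    (hh : ∀ t ∈ Icc 0 τ, h' t = h t)
    (hk : ∀ t ∈ Icc 0 τ, c' * h' t + k' t = c * h t + k t) : SolvesOn τ c' k' h' :=
  fun t ht => ((H t ht).congr hh (hh t ht)).congr_deriv (hk t ht).symm

/-- By the integrating factor: `e^{-ct}(h - h')` has zero derivative. -/
theorem SolvesOn.eq_of_eq_zero {τ : ℝ} (hτ : 0 < τ) {c : ℂ} {k h h' : ℝ → ℂ}
    (H : SolvesOn τ c k h) (H' : SolvesOn τ c k h') (h0 : h 0 = h' 0) :
    ∀ t ∈ Icc 0 τ, h t = h' t := by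
  have hder : ∀ t ∈ Icc 0 τ,
      HasDerivWithinAt (fun t : ℝ => Complex.exp (-c * t) * (h t - h' t)) 0 (Icc 0 τ) t := by
    intro t ht
    have hexp : HasDerivAt (fun t : ℝ => Complex.exp (-c * t))
        (Complex.exp (-c * t) * (-c * 1)) t :=
      ((Complex.ofRealCLM.hasDerivAt (x := t)).const_mul (-c)).cexp
    refine (hexp.hasDerivWithinAt.mul ((H t ht).sub (H' t ht))).congr_deriv ?_
    simp only [Pi.sub_apply]
    ring
  intro t ht
  have := constant_of_derivWithin_zero (fun t ht => (hder t ht).differentiableWithinAt)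
    (fun t ht => (hder t (Ico_subset_Icc_self ht)).derivWithin
      (uniqueDiffOn_Icc hτ t (Ico_subset_Icc_self ht))) t ht
  rw [h0, sub_self, mul_zero] at this
  exact sub_eq_zero.1 ((mul_eq_zero.1 this).resolve_left (Complex.exp_ne_zero _))

/-- The operator `k ↦ (t ↦ ∫₀ᵗ k)` on `C([0, τ], ℂ)`. -/
noncomputable def primitiveCLM {τ : ℝ} (hτ : 0 ≤ τ) :
    C(Icc 0 τ, ℂ) →L[ℂ] C(Icc 0 τ, ℂ) :=
  LinearMap.mkContinuous
    { toFun := fun k => ⟨fun t => ∫ u in (0 : ℝ)..t, IccExtend hτ k u,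
        (intervalIntegral.continuous_primitive (fun _ _ =>
          (k.continuous.Icc_extend' (h := hτ)).intervalIntegrable _ _) 0).comp
            continuous_subtype_val⟩
      map_add' := fun k l => by
        ext t
        exact intervalIntegral.integral_add
          ((k.continuous.Icc_extend' (h := hτ)).intervalIntegrable _ _)
          ((l.continuous.Icc_extend' (h := hτ)).intervalIntegrable _ _)
      map_smul' := fun c k => by
        ext t
        exact intervalIntegral.integral_smul c _ }
    τ fun k => by
      refine (ContinuousMap.norm_le _ (by positivity)).2 fun t => ?_
      refine (intervalIntegral.norm_integral_le_of_norm_le_const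
        (C := ‖k‖) fun u _ => k.norm_coe_le_norm _).trans ?_
      rw [sub_zero, abs_of_nonneg t.2.1, mul_comm]
      exact mul_le_mul_of_nonneg_right t.2.2 (norm_nonneg k)

/-- The function `t ↦ e^{c t}` on `[0, τ]`. -/
noncomputable def expMap (τ : ℝ) (c : ℂ) : C(Icc 0 τ, ℂ) :=
  ⟨fun t => Complex.exp (c * (t : ℝ)), by fun_prop⟩

/-- The solution operator `(h₀, k) ↦ h` of `h' = c h + k` on `[0, τ]`, `h 0 = h₀`. -/
noncomputable def solveCLM {τ : ℝ} (hτ : 0 ≤ τ) (c : ℂ) :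
    ℂ × C(Icc 0 τ, ℂ) →L[ℂ] C(Icc 0 τ, ℂ) where
  toFun x := expMap τ c * (ContinuousMap.const _ x.1 + primitiveCLM hτ (expMap τ (-c) * x.2))
  map_add' x y := by
    ext t
    simp [mul_add]
    ring
  map_smul' a x := by
    ext t
    simp [mul_smul_comm]
    ring
  cont := by fun_prop

theorem solveCLM_apply {τ : ℝ} (hτ : 0 ≤ τ) (c : ℂ) (x : ℂ × C(Icc 0 τ, ℂ)) (t : Icc 0 τ) :
    solveCLM hτ c x t = Complex.exp (c * (t : ℝ)) *
      (x.1 + ∫ u in (0 : ℝ)..t, IccExtend hτ (expMap τ (-c) * x.2) u) := rfl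

theorem solveCLM_zero {τ : ℝ} (hτ : 0 ≤ τ) (c : ℂ) (x : ℂ × C(Icc 0 τ, ℂ)) :
    solveCLM hτ c x ⟨0, left_mem_Icc.2 hτ⟩ = x.1 := by
  simp [solveCLM_apply]

theorem solvesOn_solveCLM {τ : ℝ} (hτ : 0 ≤ τ) (c : ℂ) (x : ℂ × C(Icc 0 τ, ℂ)) :
    SolvesOn τ c (IccExtend hτ x.2) (IccExtend hτ (solveCLM hτ c x)) := by
  intro t ht
  have hcont : Continuous (IccExtend hτ (expMap τ (-c) * x.2)) :=
    (expMap τ (-c) * x.2).continuous.Icc_extend' (h := hτ)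
  have hexp : HasDerivAt (fun t : ℝ => Complex.exp (c * t)) (Complex.exp (c * t) * (c * 1)) t :=
    ((Complex.ofRealCLM.hasDerivAt (x := t)).const_mul c).cexp
  have hint : HasDerivAt
      (fun t : ℝ => x.1 + ∫ u in (0 : ℝ)..t, IccExtend hτ (expMap τ (-c) * x.2) u)
      (IccExtend hτ (expMap τ (-c) * x.2) t) t :=
    (hcont.integral_hasStrictDerivAt 0 t).hasDerivAt.const_add _
  have hval : ∀ t ∈ Icc 0 τ, IccExtend hτ (solveCLM hτ c x) t = Complex.exp (c * t) *
      (x.1 + ∫ u in (0 : ℝ)..t, IccExtend hτ (expMap τ (-c) * x.2) u) := fun t ht => by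
    rw [IccExtend_of_mem _ _ ht, solveCLM_apply]
  refine ((hexp.mul hint).hasDerivWithinAt.congr hval (hval t ht)).congr_deriv ?_
  rw [hval t ht, IccExtend_of_mem _ _ ht, IccExtend_of_mem _ _ ht]
  have : Complex.exp (c * t) * Complex.exp (-c * t) = 1 := by
    rw [← Complex.exp_add]; simp
  change Complex.exp (c * t) * (c * 1) * _ +
    Complex.exp (c * t) * (Complex.exp (-c * t) * x.2 ⟨t, ht⟩) = _
  linear_combination x.2 ⟨t, ht⟩ * this

theorem SolvesOn.eq_solveCLM {τ : ℝ} (hτ : 0 < τ) {c : ℂ} {h : ℝ → ℂ} {x : ℂ × C(Icc 0 τ, ℂ)}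
    (H : SolvesOn τ c (IccExtend hτ.le x.2) h) (h0 : h 0 = x.1) (t : Icc 0 τ) :
    solveCLM hτ.le c x t = h t := by
  have := (solvesOn_solveCLM hτ.le c x).eq_of_eq_zero hτ H
    (by rw [IccExtend_of_mem _ _ (left_mem_Icc.2 hτ.le), solveCLM_zero, h0]) t t.2
  rwa [IccExtend_val] at this

/-! ### The step operator and its spectrum -/

/-- The state space of the equation with delays `τ` and `2 τ`: the restrictions of a function to
two consecutive intervals of length `τ`, the later one first. -/
abbrev State (τ : ℝ) : Type := C(Icc 0 τ, ℂ) × C(Icc 0 τ, ℂ)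

/-- The operator that advances the state by `τ`. -/
noncomputable def stepCLM {τ : ℝ} (hτ : 0 ≤ τ) (a₀ a₁ a₂ : ℂ) : State τ →L[ℂ] State τ where
  toFun x := (solveCLM hτ (-a₀) (x.1 ⟨τ, right_mem_Icc.2 hτ⟩, -(a₁ • x.1 + a₂ • x.2)), x.1)
  map_add' x y := by
    refine Prod.ext ?_ rfl
    simp only [Prod.fst_add, Prod.snd_add]
    rw [← map_add, Prod.mk_add_mk, ContinuousMap.add_apply]
    congr 2
    module
  map_smul' a x := by
    refine Prod.ext ?_ rfl
    simp only [Prod.smul_fst, Prod.smul_snd, RingHom.id_apply]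
    rw [← map_smul, Prod.smul_mk, ContinuousMap.smul_apply]
    congr 2
    module
  cont := by fun_prop

theorem stepCLM_apply {τ : ℝ} (hτ : 0 ≤ τ) (a₀ a₁ a₂ : ℂ) (x : State τ) :
    stepCLM hτ a₀ a₁ a₂ x =
      (solveCLM hτ (-a₀) (x.1 ⟨τ, right_mem_Icc.2 hτ⟩, -(a₁ • x.1 + a₂ • x.2)), x.1) := rfl

/-- For an eigenvector `(f, g)` with image `(h, f)`, `f = h/l` and `g = h/l²`, so `h' = s h` with `s
= -(a₀ + a₁/l + a₂/l²)`. Then `h(τ) = e^{sτ} h(0)`, while `h(τ) = l f(τ) = l h(0)`; as `e^{sτ} ≠ l`,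
`h` vanishes. -/
theorem injective_smul_sub_stepCLM {τ : ℝ} (hτ : 0 < τ) (a₀ a₁ a₂ : ℂ) {l : ℂ} (hl : l ≠ 0)
    (hexp : Complex.exp (-(a₀ + a₁ / l + a₂ / l ^ 2) * τ) ≠ l) {x : State τ}
    (hx : stepCLM hτ.le a₀ a₁ a₂ x = l • x) : x = 0 := by
  obtain ⟨f, g⟩ := x
  rw [stepCLM_apply, Prod.smul_mk, Prod.mk.injEq] at hx
  obtain ⟨h1, h2⟩ := hx
  simp only at h1 h2
  set h := solveCLM hτ.le (-a₀) (f ⟨τ, right_mem_Icc.2 hτ.le⟩, -(a₁ • f + a₂ • g)) with hdef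
  have hh0 : h ⟨0, left_mem_Icc.2 hτ.le⟩ = f ⟨τ, right_mem_Icc.2 hτ.le⟩ := solveCLM_zero _ _ _
  have hsol : SolvesOn τ (-(a₀ + a₁ / l + a₂ / l ^ 2)) (fun _ => 0) (IccExtend hτ.le h) := by
    refine (solvesOn_solveCLM hτ.le _ _).congr (fun _ _ => rfl) fun t ht => ?_
    simp only [IccExtend_of_mem _ _ ht, ← hdef]
    have e1 := congrArg (· ⟨t, ht⟩) h1
    have e2 := congrArg (· ⟨t, ht⟩) h2
    simp at e1 e2 ⊢
    rw [e1, e2]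
    field_simp
    ring
  have hsol' : SolvesOn τ (-(a₀ + a₁ / l + a₂ / l ^ 2)) (fun _ => 0)
      (fun t => Complex.exp (-(a₀ + a₁ / l + a₂ / l ^ 2) * t) *
        h ⟨0, left_mem_Icc.2 hτ.le⟩) := fun t _ =>
    ((((Complex.ofRealCLM.hasDerivAt (x := t)).const_mul _).cexp.mul_const
      _).congr_deriv (by simp; ring)).hasDerivWithinAt
  have heq := hsol.eq_of_eq_zero hτ hsol' (by
    rw [IccExtend_of_mem _ _ (left_mem_Icc.2 hτ.le)]; simp)
  have hend := heq τ (right_mem_Icc.2 hτ.le)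
  rw [IccExtend_of_mem _ _ (right_mem_Icc.2 hτ.le)] at hend
  have hz : h ⟨0, left_mem_Icc.2 hτ.le⟩ = 0 := by
    have e1 := congrArg (· ⟨τ, right_mem_Icc.2 hτ.le⟩) h1
    simp only [ContinuousMap.smul_apply, smul_eq_mul] at e1
    rw [e1, ← hh0] at hend
    by_contra hne
    exact hexp (mul_right_cancel₀ hne hend).symm
  have hf : f = 0 := by
    ext t
    have := heq t t.2
    rw [IccExtend_val, hz, mul_zero, h1] at this
    exact (mul_eq_zero.1 this).resolve_left hl
  subst hf
  exact Prod.ext rfl ((smul_eq_zero.1 h2.symm).resolve_left hl)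

/-- The resolvent equation says `f = (h + p)/l`, `g = (f + q)/l`, where `h` is the first component
of the image of `(f, g)`. Substitution leaves `h' = s h + k` with the matching condition `h(0) =
f(τ)`. -/
theorem surjective_smul_sub_stepCLM {τ : ℝ} (hτ : 0 < τ) (a₀ a₁ a₂ : ℂ) {l : ℂ} (hl : l ≠ 0)
    (hexp : Complex.exp (-(a₀ + a₁ / l + a₂ / l ^ 2) * τ) ≠ l) (y : State τ) :
    ∃ x : State τ, l • x - stepCLM hτ.le a₀ a₁ a₂ x = y := by
  obtain ⟨p, q⟩ := y
  set s := -(a₀ + a₁ / l + a₂ / l ^ 2) with hs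
  set T : Icc 0 τ := ⟨τ, right_mem_Icc.2 hτ.le⟩ with hT
  set k : C(Icc 0 τ, ℂ) := -((a₁ / l + a₂ / l ^ 2) • p + (a₂ / l) • q) with hk
  -- The matching condition is `l h₀ = h(τ) + p(τ)`, and `h(τ)` is `e^{sτ} h₀` plus the solution
  -- started from `0`; solve for `h₀`.
  set h₀ : ℂ := (solveCLM hτ.le s (0, k) T + p T) / (l - Complex.exp (s * τ)) with hh₀
  set h := solveCLM hτ.le s (h₀, k) with hdef
  have hne : l - Complex.exp (s * τ) ≠ 0 := sub_ne_zero.2 hexp.symm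
  have hend : h T + p T = l * h₀ := by
    have : h T = Complex.exp (s * τ) * h₀ + solveCLM hτ.le s (0, k) T := by
      rw [hdef, solveCLM_apply, solveCLM_apply]; simp only [hT]; ring
    rw [this, hh₀]
    field_simp
    ring
  set f : C(Icc 0 τ, ℂ) := l⁻¹ • (h + p) with hf
  set g : C(Icc 0 τ, ℂ) := l⁻¹ • (f + q) with hg
  have hstep : solveCLM hτ.le (-a₀) (f T, -(a₁ • f + a₂ • g)) = h := by
    ext t
    rw [SolvesOn.eq_solveCLM hτ (h := IccExtend hτ.le h) _ _ t, IccExtend_val]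
    · refine (solvesOn_solveCLM hτ.le s (h₀, k)).congr (fun _ _ => rfl) fun t ht => ?_
      simp only [IccExtend_of_mem _ _ ht, ← hdef]
      simp [hk, hf, hg, hs]
      field_simp
      ring
    · rw [IccExtend_of_mem _ _ (left_mem_Icc.2 hτ.le), hdef, solveCLM_zero]
      simp only [hf, ContinuousMap.smul_apply, ContinuousMap.add_apply, hend, smul_eq_mul]
      field_simp
  refine ⟨(f, g), ?_⟩
  rw [stepCLM_apply, hstep, Prod.smul_mk, Prod.mk_sub_mk]
  refine Prod.ext ?_ ?_
  · change l • l⁻¹ • (h + p) - h = p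
    rw [smul_inv_smul₀ hl, add_sub_cancel_left]
  · change l • l⁻¹ • (f + q) - f = q
    rw [smul_inv_smul₀ hl, add_sub_cancel_left]

theorem exp_eq_of_mem_spectrum_stepCLM {τ : ℝ} (hτ : 0 < τ) (a₀ a₁ a₂ : ℂ) {l : ℂ} (hl : l ≠ 0)
    (hmem : l ∈ spectrum ℂ (stepCLM hτ.le a₀ a₁ a₂)) :
    Complex.exp (-(a₀ + a₁ / l + a₂ / l ^ 2) * τ) = l := by
  by_contra hexp
  refine hmem (ContinuousLinearMap.isUnit_iff_bijective.2 ⟨?_, fun y => ?_⟩)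
  · refine (injective_iff_map_eq_zero _).2 fun x hx =>
      injective_smul_sub_stepCLM hτ a₀ a₁ a₂ hl hexp ?_
    exact (sub_eq_zero.1 hx).symm
  · exact surjective_smul_sub_stepCLM hτ a₀ a₁ a₂ hl hexp y

/-- For nonzero `l` in the spectrum, `s = -(a₀ + a₁/l + a₂/l²)` satisfies `e^{sτ} = l`, which turns
its definition into `Δ(s) = 0`; thus `|l| = e^{τ Re s}`. -/
theorem spectralRadius_stepCLM_le {τ : ℝ} (hτ : 0 < τ) {a₀ a₁ a₂ σ : ℝ}
    (hroots : ∀ s : ℂ, charFun a₀ a₁ a₂ τ (2 * τ) s = 0 → s.re ≤ σ) :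
    spectralRadius ℂ (stepCLM hτ.le a₀ a₁ a₂) ≤ ENNReal.ofReal (Real.exp (σ * τ)) := by
  refine iSup₂_le fun l hmem => ?_
  by_cases hl : l = 0
  · simp [hl]
  have hexp := exp_eq_of_mem_spectrum_stepCLM hτ _ _ _ hl hmem
  set s : ℂ := -(a₀ + a₁ / l + a₂ / l ^ 2) with hs
  have hroot : charFun a₀ a₁ a₂ τ (2 * τ) s = 0 := by
    have e1 : Complex.exp (-s * τ) = l⁻¹ := by rw [neg_mul, Complex.exp_neg, hexp]
    have e2 : Complex.exp (-s * (2 * τ : ℝ)) = (l⁻¹) ^ 2 := by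
      rw [← e1, ← Complex.exp_nat_mul]; push_cast; ring_nf
    rw [charFun, e1, e2, hs]
    field_simp
    ring
  rw [← enorm_eq_nnnorm, ← ofReal_norm]
  refine ENNReal.ofReal_le_ofReal ?_
  rw [← hexp, Complex.norm_exp]
  simp
  exact mul_le_mul_of_nonneg_right (hroots s hroot) hτ.le

/-! ### Solutions as orbits of the step operator, and their decay -/

/-- The restriction of `y` to `[a, a + τ]`, translated to `[0, τ]`. -/
noncomputable def segment (τ : ℝ) {y : ℝ → ℝ} {b : ℝ} (hy : ContinuousOn y (Ici b)) {a : ℝ}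
    (ha : b ≤ a) : C(Icc 0 τ, ℂ) where
  toFun t := (y (a + t) : ℂ)
  continuous_toFun := Complex.continuous_ofReal.comp <| hy.comp_continuous (by fun_prop)
    fun t => by have := t.2.1; simp only [mem_Ici]; linarith

theorem le_natCast_mul_sub {τ : ℝ} (hτ : 0 ≤ τ) (n : ℕ) : -(2 * τ) ≤ n * τ - 2 * τ := by
  have : 0 ≤ n * τ := by positivity
  linarith

/-- The state of `y` on `[n τ - 2 τ, n τ]`. -/
noncomputable def stateAt {τ : ℝ} (hτ : 0 ≤ τ) {y : ℝ → ℝ} (hy : ContinuousOn y (Ici (-(2 * τ))))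
    (n : ℕ) : State τ :=
  (segment τ hy (le_natCast_mul_sub hτ (n + 1)), segment τ hy (le_natCast_mul_sub hτ n))

theorem stepCLM_stateAt {τ : ℝ} (hτ : 0 < τ) {a₀ a₁ a₂ : ℝ} {y : ℝ → ℝ}
    (hy : IsSolution a₀ a₁ a₂ τ (2 * τ) y) (n : ℕ) :
    stepCLM hτ.le a₀ a₁ a₂ (stateAt hτ.le hy.1 n) = stateAt hτ.le hy.1 (n + 1) := by
  refine Prod.ext ?_ rfl
  ext t
  let k : C(Icc 0 τ, ℂ) :=
    -((a₁ : ℂ) • (stateAt hτ.le hy.1 n).1 + (a₂ : ℂ) • (stateAt hτ.le hy.1 n).2)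
  have hsol : SolvesOn τ (-a₀) (IccExtend hτ.le k)
      (fun t => (y (n * τ + t) : ℂ)) := by
    intro t ht
    have hn : 0 ≤ n * τ := by positivity
    have hder := hy.2 (n * τ + t) (by linarith [ht.1])
    have hcomp := (hder.comp (s := Icc 0 τ) t
      ((hasDerivAt_id t).const_add (n * τ)).hasDerivWithinAt
      fun u hu => by have := hu.1; simp only [mem_Ici]; linarith).ofReal_comp
    refine hcomp.congr_deriv ?_
    rw [IccExtend_of_mem _ _ ht]
    have e1 : ((n + 1 : ℕ) : ℝ) * τ - 2 * τ + t = n * τ + t - τ := by push_cast; ring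
    have e2 : (n : ℝ) * τ - 2 * τ + t = n * τ + t - 2 * τ := by ring
    simp [k, stateAt, segment, -Nat.cast_add, e1, e2]
    ring
  have h0 : (y (n * τ + 0) : ℂ) = (stateAt hτ.le hy.1 n).1 ⟨τ, right_mem_Icc.2 hτ.le⟩ := by
    simp only [stateAt, segment, ContinuousMap.coe_mk]
    congr 2
    push_cast
    ring
  refine (SolvesOn.eq_solveCLM hτ (x := (_, k)) hsol h0 t).trans ?_
  simp only [stateAt, segment, ContinuousMap.coe_mk]
  congr 2
  push_cast
  ring

theorem stateAt_eq_pow {τ : ℝ} (hτ : 0 < τ) {a₀ a₁ a₂ : ℝ} {y : ℝ → ℝ}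
    (hy : IsSolution a₀ a₁ a₂ τ (2 * τ) y) (n : ℕ) :
    stateAt hτ.le hy.1 n = (stepCLM hτ.le a₀ a₁ a₂ ^ n) (stateAt hτ.le hy.1 0) := by
  induction n with
  | zero => simp
  | succ n ih => rw [pow_succ', mul_apply_eq_comp, ← ih, stepCLM_stateAt hτ hy]

theorem abs_le_historyNorm {τ₂ : ℝ} {y : ℝ → ℝ} (hy : ContinuousOn y (Ici (-τ₂))) {t : ℝ}
    (ht : t ∈ Icc (-τ₂) 0) : |y t| ≤ historyNorm τ₂ y :=
  le_csSup (isCompact_Icc.bddAbove_image (hy.mono Icc_subset_Ici_self).abs) ⟨t, ht, rfl⟩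

theorem norm_stateAt_zero_le {τ : ℝ} (hτ : 0 < τ) {y : ℝ → ℝ}
    (hy : ContinuousOn y (Ici (-(2 * τ)))) : ‖stateAt hτ.le hy 0‖ ≤ historyNorm (2 * τ) y := by
  have h0 : 0 ≤ historyNorm (2 * τ) y :=
    (abs_nonneg _).trans (abs_le_historyNorm hy (right_mem_Icc.2 (by linarith)))
  refine max_le ((ContinuousMap.norm_le _ h0).2 fun t => ?_)
    ((ContinuousMap.norm_le _ h0).2 fun t => ?_)
  all_goals
    simp only [stateAt, segment, ContinuousMap.coe_mk, Complex.norm_real, Real.norm_eq_abs]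
    refine abs_le_historyNorm hy ⟨?_, ?_⟩ <;> have := t.2.1 <;> have := t.2.2 <;> push_cast <;>
      linarith

theorem abs_le_norm_stateAt {τ : ℝ} (hτ : 0 < τ) {y : ℝ → ℝ}
    (hy : ContinuousOn y (Ici (-(2 * τ)))) {n : ℕ} {t : ℝ}
    (ht : t ∈ Icc (n * τ - τ) (n * τ)) : |y t| ≤ ‖stateAt hτ.le hy n‖ := by
  have h := (stateAt hτ.le hy n).1.norm_coe_le_norm
    ⟨t - (n * τ - τ), by linarith [ht.1], by linarith [ht.2]⟩
  refine le_trans (le_of_eq ?_) (h.trans (norm_fst_le (stateAt hτ.le hy n)))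
  simp only [stateAt, segment, ContinuousMap.coe_mk, Complex.norm_real, Real.norm_eq_abs]
  congr 2
  push_cast
  ring

theorem exists_norm_pow_apply_le_of_spectralRadius_lt {E : Type*} [NormedAddCommGroup E]
    [NormedSpace ℂ E] [CompleteSpace E] (T : E →L[ℂ] E) {r : ℝ} (hr : 0 < r)
    (h : spectralRadius ℂ T < ENNReal.ofReal r) :
    ∃ C : ℝ, 0 < C ∧ ∀ (n : ℕ) (x : E), ‖(T ^ n) x‖ ≤ C * r ^ n * ‖x‖ := by
  obtain ⟨C, hC, hpow⟩ := exists_norm_pow_le_of_spectralRadius_lt T hr h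
  exact ⟨C, hC, fun n x => ((T ^ n).le_opNorm x).trans
    (mul_le_mul_of_nonneg_right (hpow n) (norm_nonneg x))⟩

theorem exists_norm_stateAt_le {τ : ℝ} (hτ : 0 < τ) {a₀ a₁ a₂ σ ρ : ℝ} (hσ : σ < ρ)
    (hroots : ∀ s : ℂ, charFun a₀ a₁ a₂ τ (2 * τ) s = 0 → s.re ≤ σ) :
    ∃ C : ℝ, 0 < C ∧ ∀ (y : ℝ → ℝ) (hy : IsSolution a₀ a₁ a₂ τ (2 * τ) y) (n : ℕ),
      ‖stateAt hτ.le hy.1 n‖ ≤ C * Real.exp (ρ * τ) ^ n * historyNorm (2 * τ) y := by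
  have hrad : spectralRadius ℂ (stepCLM hτ.le (a₀ : ℂ) a₁ a₂) <
      ENNReal.ofReal (Real.exp (ρ * τ)) :=
    lt_of_le_of_lt (spectralRadius_stepCLM_le hτ hroots)
      ((ENNReal.ofReal_lt_ofReal_iff (Real.exp_pos _)).2
        (Real.exp_lt_exp.2 (mul_lt_mul_of_pos_right hσ hτ)))
  obtain ⟨C, hC, hpow⟩ := exists_norm_pow_apply_le_of_spectralRadius_lt
    (stepCLM hτ.le (a₀ : ℂ) a₁ a₂) (Real.exp_pos (ρ * τ)) hrad
  refine ⟨C, hC, fun y hy n => ?_⟩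
  rw [stateAt_eq_pow hτ hy n]
  exact (hpow n _).trans
    (mul_le_mul_of_nonneg_left (norm_stateAt_zero_le hτ hy.1) (by positivity))

theorem isExponentiallyStable_of_re_le {τ : ℝ} (hτ : 0 < τ) {a₀ a₁ a₂ σ : ℝ} (hσ : σ < 0)
    (hroots : ∀ s : ℂ, charFun a₀ a₁ a₂ τ (2 * τ) s = 0 → s.re ≤ σ) :
    IsExponentiallyStable a₀ a₁ a₂ τ (2 * τ) := by
  obtain ⟨C, hC, hbound⟩ :=
    -- Gelfand's formula needs a rate strictly above `σ`; `σ/2` is still negative.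
    exists_norm_stateAt_le hτ (show σ < σ / 2 by linarith) hroots
  refine ⟨C, -(σ / 2), hC, by linarith, fun y hy t ht => ?_⟩
  have hhist : 0 ≤ historyNorm (2 * τ) y := (norm_nonneg _).trans (norm_stateAt_zero_le hτ hy.1)
  -- Rounding up past `t` gives `t ≤ nτ`, so, the rate `σ/2` being negative, `e^{(σ/2)nτ} ≤
  -- e^{(σ/2)t}` without an extra constant.
  set n := ⌊t / τ⌋₊ + 1 with hn
  have h1 : t ≤ n * τ := by
    rw [← div_le_iff₀ hτ, hn]
    exact_mod_cast (Nat.lt_floor_add_one (t / τ)).le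
  have h2 : n * τ - τ ≤ t := by
    have := (le_div_iff₀ hτ).1 (Nat.floor_le (div_nonneg ht hτ.le))
    rw [hn]
    push_cast
    linarith
  have hexp : Real.exp (σ / 2 * τ) ^ n ≤ Real.exp (-(-(σ / 2)) * t) := by
    rw [← Real.exp_nat_mul, Real.exp_le_exp]
    nlinarith
  exact ((abs_le_norm_stateAt hτ hy.1 ⟨h2, h1⟩).trans (hbound y hy n)).trans
    (mul_le_mul_of_nonneg_right (mul_le_mul_of_nonneg_left hexp hC.le) hhist)

end TwoDelay

theorem mainTheorem1 (a₀ a₁ a₂ τ₁ τ₂ s₀ : ℝ) (hτ₁ : 0 < τ₁) (hτ : τ₁ < τ₂)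
    (hratio : τ₁ / τ₂ = 1 / 2)
    (hs₀ : TwoDelay.IsRootOfMultiplicity (TwoDelay.charFun a₀ a₁ a₂ τ₁ τ₂) s₀ 3) :
    TwoDelay.IsStrictlyDominantRoot (TwoDelay.charFun a₀ a₁ a₂ τ₁ τ₂) s₀ ∧
      (s₀ < 0 → TwoDelay.IsExponentiallyStable a₀ a₁ a₂ τ₁ τ₂) := by
  obtain rfl : τ₂ = 2 * τ₁ := by
    rw [div_eq_iff (hτ₁.trans hτ).ne'] at hratio
    linarith
  have hdom := TwoDelay.isStrictlyDominantRoot_of_triple_root hτ₁ hs₀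
  -- The bound `Re s ≤ s₀ < 0` is uniform over all roots, so `σ = s₀` serves.
  refine ⟨hdom, fun hneg => TwoDelay.isExponentiallyStable_of_re_le hτ₁ hneg fun s hs => ?_⟩
  rcases hdom.2 s hs with rfl | h
  · simp
  · exact h.le
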